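/- Let $J_k$ and $I_k$ denote the Bessel function and the modified Bessel function of the first kind of order $k$, and for $k\in\mathbb N=\{0,1,2,\dots\}$ let $0<j_{k,1}<j_{k,2}<\cdots$ be the positive zeros of $J_k$. Let $k\in\mathbb N$, let $\kappa>0$, and for $\alpha>0$ put $$F_k(\alpha)=\frac{\kappa}{\alpha}\,J_k(\alpha)\,I_k'\Bigl(\frac{\kappa}{\alpha}\Bigr)-\alpha\,I_k\Bigl(\frac{\kappa}{\alpha}\Bigr)J_k'(\alpha).$$ Then every positive root of $F_k$ is simple, and the set of all positive roots of $F_k$ can be ordered as an increasing infinite sequence $(\alpha_{k,\ell})_{\ell\ge 1}$ such that $$j_{k,\ell}<\alpha_{k,\ell}<j_{k+1,\ell}\qquad\text{for all }\ell\ge 1.$$ Moreover, for each $\ell\ge1$ the number $$\lambda_{k,\ell}=\alpha_{k,\ell}^2-\frac{\kappa^2}{\alpha_{k,\ell}^2}$$ is an eigenvalue of the problem $$\Delta^2u-\kappa^2u=-\lambda\,\Delta u\ \text{ in } D_1,\qquad u=\partial_ru=0\ \text{ on }\partial D_1,$$ where $D_1$ is the open unit disk of $\mathbb R^2$; that is,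 for $\lambda=\lambda_{k,\ell}$ this problem has a solution $u\neq 0$, complex-valued and of class $C^4$ on $\overline{D_1}$ (an eigenfunction). With $\alpha=\alpha_{k,\ell}$, the linear system $$c\,J_k(\alpha)+d\,I_k\Bigl(\frac{\kappa}{\alpha}\Bigr)=0,\qquad c\,\alpha J_k'(\alpha)+d\,\frac{\kappa}{\alpha}I_k'\Bigl(\frac{\kappa}{\alpha}\Bigr)=0$$ has a real solution $(c,d)\neq(0,0)$, and for every such solution the functions given in polar coordinates $(r,\theta)$ by $R_{k,\ell}(r)e^{ik\theta}$ and $R_{k,\ell}(r)e^{-ik\theta}$, where $$R_{k,\ell}(r)=c\,J_k(\alpha_{k,\ell}\,r)+d\,I_k\Bigl(\frac{\kappa}{\alpha_{k,\ell}}\,r\Bigr),$$ are eigenfunctions for the eigenvalue $\lambda_{k,\ell}$. -/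

import Mathlib

open Metric Laplacian InnerProductSpace

namespace BallBuckling

/-- The Bessel function of the first kind `J_k` of integer order `k ≥ 0`. -/
noncomputable def besselJ (k : ℕ) (x : ℝ) : ℝ :=
  ∑' m : ℕ, (-1 : ℝ) ^ m / ((m.factorial : ℝ) * ((m + k).factorial : ℝ)) * (x / 2) ^ (2 * m + k)

/-- The modified Bessel function of the first kind `I_k` of integer order `k ≥ 0`. -/
noncomputable def besselI (k : ℕ) (x : ℝ) : ℝ :=
  ∑' m : ℕ, 1 / ((m.factorial : ℝ) * ((m + k).factorial : ℝ)) * (x / 2) ^ (2 * m + k)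

/-- For `ℓ ≥ 1`, the `ℓ`-th positive zero `j_{k,ℓ}` of `J_k`, in increasing order: `j_{k,ℓ+1}` is
the first zero of `J_k` to the right of `j_{k,ℓ}`. The value `0` at `ℓ = 0` only starts the
recursion. -/
noncomputable def besselJZero (k : ℕ) : ℕ → ℝ
  | 0 => 0
  | ℓ + 1 => sInf {x : ℝ | besselJZero k ℓ < x ∧ besselJ k x = 0}

/-- `F_k(α) = (κ/α) J_k(α) I_k'(κ/α) - α I_k(κ/α) J_k'(α)`, of interest for `α > 0`. -/
noncomputable def charF (k : ℕ) (κ α : ℝ) : ℝ :=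
  κ / α * besselJ k α * deriv (besselI k) (κ / α)
    - α * besselI k (κ / α) * deriv (besselJ k) α

/-- The linear system for `(c, d)` expressing that `r ↦ c J_k(α r) + d I_k(κ r / α)` and its
derivative vanish at `r = 1`. -/
def BoundarySystem (k : ℕ) (κ α c d : ℝ) : Prop :=
  c * besselJ k α + d * besselI k (κ / α) = 0 ∧
  c * (α * deriv (besselJ k) α) + d * (κ / α * deriv (besselI k) (κ / α)) = 0

/-- The radial profile `R(r) = c J_k(α r) + d I_k(κ r / α)`. -/
noncomputable def radialProfile (k : ℕ) (κ α c d r : ℝ) : ℝ :=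
  c * besselJ k (α * r) + d * besselI k (κ / α * r)

/-- The function `R(r) e^{i n θ}` in polar coordinates `(r, θ)`, as a function on the Euclidean
plane `ℝ² = ℂ`. -/
noncomputable def polarMode (R : ℝ → ℝ) (n : ℤ) (z : ℂ) : ℂ :=
  (R ‖z‖ : ℂ) * Complex.exp (Complex.I * n * Complex.arg z)

/-- `u` is a (classical, complex-valued) eigenfunction, for the real number `lam`, of
`Δ² u - κ² u = - lam Δ u` in the open unit disk, `u = ∂_r u = 0` on the unit circle.
The plane `ℝ²` is `ℂ` with its real Euclidean structure; at a point `z` of the unit circle the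
outward unit normal is `z` itself. -/
structure IsEigenfunction (κ lam : ℝ) (u : ℂ → ℂ) : Prop where
  regular : ContDiffOn ℝ 4 u (closedBall 0 1)
  equation : ∀ z ∈ ball (0 : ℂ) 1, Δ (Δ u) z - (κ : ℂ) ^ 2 * u z = -(lam : ℂ) * Δ u z
  boundary_value : ∀ z ∈ sphere (0 : ℂ) 1, u z = 0
  boundary_normal : ∀ z ∈ sphere (0 : ℂ) 1, fderivWithin ℝ u (closedBall 0 1) z z = 0
  nontrivial : ∃ z ∈ ball (0 : ℂ) 1, u z ≠ 0

/-- `lam` is an eigenvalue of the clamped problem on the unit disk. -/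
def IsEigenvalue (κ lam : ℝ) : Prop := ∃ u : ℂ → ℂ, IsEigenfunction κ lam u

end BallBuckling

/-! Write y = κ/α. The derivative formulas turn F_k into y J_k(α) I_{k+1}(y) + α I_k(y) J_{k+1}(α).
Since I_k and I_{k+1} are positive, a root needs J_k and J_{k+1} of opposite signs; by interlacing
of their zeros this happens only in the intervals (j_{k,ℓ}, j_{k+1,ℓ}). F_k changes sign across each
of them, so a root exists (`exists_charF_eq_zero`). It is unique and simple because at every root
J_k F_k' > 0 (`besselJ_mul_deriv_charF_pos`): this reduces to a quadratic form in I_k, I_{k+1},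
positive by Turán's inequality, with the extra input j_{0,1} > 1 when k = 0.

For the eigenfunctions, z^k C_k(s|z|²) satisfies Δu = 4su (`laplacian_planeMode`), so the J- and
I-parts of a mode have Laplace eigenvalues -α² and κ²/α². These are the two roots μ of μ² + λμ - κ²
= 0, which gives the equation. F_k(α) is the determinant of the boundary system. -/

namespace BallBuckling

/-! ### The Bessel–Clifford series -/

/-- The Bessel–Clifford function `C_k(t) = ∑ t^m / (m! (m+k)!)`. -/
noncomputable def besselClifford (k : ℕ) (t : ℝ) : ℝ :=
  ∑' m : ℕ, t ^ m / ((m.factorial : ℝ) * ((m + k).factorial : ℝ))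

lemma abs_besselClifford_term_le (k m : ℕ) (t : ℝ) :
    |t ^ m / ((m.factorial : ℝ) * ((m + k).factorial : ℝ))| ≤ |t| ^ m / m.factorial := by
  rw [abs_div, abs_pow, abs_of_pos (a := (m.factorial : ℝ) * _) (by positivity)]
  have h1 : (1 : ℝ) ≤ ((m + k).factorial : ℝ) := by exact_mod_cast Nat.factorial_pos _
  have h2 : (0 : ℝ) < m.factorial := by positivity
  gcongr
  nlinarith

lemma summable_besselClifford (k : ℕ) (t : ℝ) :
    Summable fun m : ℕ => t ^ m / ((m.factorial : ℝ) * ((m + k).factorial : ℝ)) :=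
  Summable.of_norm_bounded (Real.summable_pow_div_factorial |t|)
    fun m => abs_besselClifford_term_le k m t

lemma hasDerivAt_besselClifford (k : ℕ) (t : ℝ) :
    HasDerivAt (besselClifford k) (besselClifford (k + 1) t) t := by
  have hterm : ∀ (m : ℕ) (y : ℝ),
      (m + 1 : ℕ) * y ^ m / (((m + 1).factorial : ℝ) * ((m + 1 + k).factorial : ℝ))
        = y ^ m / ((m.factorial : ℝ) * ((m + (k + 1)).factorial : ℝ)) := by
    intro m y
    have h0 : (m.factorial : ℝ) ≠ 0 := by positivity
    have h1 : ((m + (k + 1)).factorial : ℝ) ≠ 0 := by positivity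
    have h2 : m + 1 + k = m + (k + 1) := by ring
    rw [h2, Nat.factorial_succ]
    push_cast
    have : (m + 1 : ℝ) ≠ 0 := by positivity
    field_simp
  set R := |t| + 1
  have key := hasDerivAt_tsum_of_isPreconnected (𝕜 := ℝ) (F := ℝ)
    -- Truncation at `m = 0` is harmless: that term has zero derivative.
    (u := fun m : ℕ => R ^ (m - 1) / (m - 1).factorial)
    (g := fun (m : ℕ) (y : ℝ) => y ^ m / ((m.factorial : ℝ) * ((m + k).factorial : ℝ)))
    (g' := fun (m : ℕ) (y : ℝ) =>
      m * y ^ (m - 1) / ((m.factorial : ℝ) * ((m + k).factorial : ℝ)))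
    (t := ball (0 : ℝ) R) (y₀ := 0) (y := t) ?_ isOpen_ball
    (convex_ball 0 R).isPreconnected ?_ ?_ ?_ (summable_besselClifford k 0) ?_
  · refine HasDerivAt.congr_deriv (f := besselClifford k) key ?_
    rw [besselClifford, ((summable_nat_add_iff 1).1 _).tsum_eq_zero_add]
    · simp only [Nat.add_sub_cancel, hterm]
      simp
    · simp only [Nat.add_sub_cancel]
      simpa only [hterm] using summable_besselClifford (k + 1) t
  · refine (summable_nat_add_iff 1).1 ?_
    simpa using Real.summable_pow_div_factorial R
  · intro m y _
    exact (hasDerivAt_pow m y).div_const _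
  · intro m y hy
    have hy' : |y| ≤ R := by simpa using (mem_ball_zero_iff.1 hy).le
    cases m with
    | zero => simp
    | succ m =>
      simp only [Nat.add_sub_cancel, hterm, Real.norm_eq_abs]
      refine (abs_besselClifford_term_le _ _ _).trans ?_
      gcongr
  · simp [R]; positivity
  · simp [R]; 

lemma contDiff_besselClifford (k : ℕ) {n : ℕ∞} : ContDiff ℝ n (besselClifford k) := by
  suffices h : ∀ (n : ℕ) (k : ℕ), ContDiff ℝ n (besselClifford k) by
    exact (contDiff_infty.2 fun n => h n k).of_le (by exact_mod_cast le_top)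
  intro n
  induction n with
  | zero =>
    intro k
    exact contDiff_zero.2 (Differentiable.continuous
      fun t => (hasDerivAt_besselClifford k t).differentiableAt)
  | succ n ih =>
    intro k
    push_cast
    refine contDiff_succ_iff_deriv.2
      ⟨fun t => (hasDerivAt_besselClifford k t).differentiableAt, by simp, ?_⟩
    rw [show deriv (besselClifford k) = besselClifford (k + 1) from
      funext fun t => (hasDerivAt_besselClifford k t).deriv]
    exact ih _

lemma continuous_besselClifford (k : ℕ) : Continuous (besselClifford k) :=
  (contDiff_besselClifford k (n := 0)).continuous

lemma besselClifford_recurrence (k : ℕ) (t : ℝ) :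
    besselClifford k t =
      (k + 1) * besselClifford (k + 1) t + t * besselClifford (k + 2) t := by
  have hs : Summable fun m : ℕ =>
      (m : ℝ) * (t ^ m / ((m.factorial : ℝ) * ((m + (k + 1)).factorial : ℝ))) := by
    -- Termwise, m times the term of C_{k+1} is the term of C_k minus (k+1) times that of C_{k+1}.
    refine ((summable_besselClifford k t).sub
      ((summable_besselClifford (k + 1) t).mul_left (k + 1 : ℝ))).congr fun m => ?_
    have h0 : (m.factorial : ℝ) ≠ 0 := by positivity
    have h1 : ((m + k).factorial : ℝ) ≠ 0 := by positivity
    rw [← add_assoc, Nat.factorial_succ]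
    push_cast
    have : (m + k + 1 : ℝ) ≠ 0 := by positivity
    field_simp
    ring
  have h2 : t * besselClifford (k + 2) t = ∑' m : ℕ,
      (m : ℝ) * (t ^ m / ((m.factorial : ℝ) * ((m + (k + 1)).factorial : ℝ))) := by
    rw [hs.tsum_eq_zero_add, besselClifford, ← tsum_mul_left]
    simp only [Nat.cast_zero, zero_mul, zero_add]
    refine tsum_congr fun m => ?_
    have h0 : (m.factorial : ℝ) ≠ 0 := by positivity
    have h1 : ((m + (k + 2)).factorial : ℝ) ≠ 0 := by positivity
    rw [show m + 1 + (k + 1) = m + (k + 2) by ring, Nat.factorial_succ]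
    push_cast
    have : (m + 1 : ℝ) ≠ 0 := by positivity
    field_simp
    ring
  rw [h2, besselClifford, besselClifford, ← tsum_mul_left,
    ← ((summable_besselClifford (k + 1) t).mul_left _).tsum_add hs]
  refine tsum_congr fun m => ?_
  have h0 : (m.factorial : ℝ) ≠ 0 := by positivity
  have h1 : ((m + k).factorial : ℝ) ≠ 0 := by positivity
  rw [← add_assoc, Nat.factorial_succ]
  push_cast
  have : (m + k + 1 : ℝ) ≠ 0 := by positivity
  field_simp
  ring

lemma besselClifford_pos (k : ℕ) {t : ℝ} (ht : 0 ≤ t) : 0 < besselClifford k t :=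
  (summable_besselClifford k t).tsum_pos (fun m => by positivity) 0 (by simp; positivity)

/-! ### J and I together: recurrences and Turán's inequality -/

/-- `(x/2)^k C_k(ε x²/4)`: the Bessel function `J_k` for `ε = -1` and the modified Bessel function
`I_k` for `ε = 1`. -/
noncomputable def signedBessel (ε : ℝ) (k : ℕ) (x : ℝ) : ℝ :=
  (x / 2) ^ k * besselClifford k (ε * (x / 2) ^ 2)

lemma besselJ_eq (k : ℕ) : besselJ k = signedBessel (-1) k := by
  funext x
  rw [besselJ, signedBessel, besselClifford, ← tsum_mul_left]
  refine tsum_congr fun m => ?_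
  rw [mul_pow, pow_add, pow_mul]
  ring

lemma besselI_eq (k : ℕ) : besselI k = signedBessel 1 k := by
  funext x
  rw [besselI, signedBessel, besselClifford, ← tsum_mul_left]
  refine tsum_congr fun m => ?_
  rw [mul_pow, pow_add, pow_mul]
  ring

lemma contDiff_signedBessel (ε : ℝ) (k : ℕ) {n : ℕ∞} : ContDiff ℝ n (signedBessel ε k) := by
  unfold signedBessel
  have := contDiff_besselClifford k (n := n)
  fun_prop

lemma continuous_signedBessel (ε : ℝ) (k : ℕ) : Continuous (signedBessel ε k) :=
  (contDiff_signedBessel ε k (n := 0)).continuous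

lemma signedBessel_recurrence (ε : ℝ) (k : ℕ) {x : ℝ} (hx : x ≠ 0) :
    signedBessel ε k x =
      2 * (k + 1) / x * signedBessel ε (k + 1) x + ε * signedBessel ε (k + 2) x := by
  simp only [signedBessel]
  rw [besselClifford_recurrence k]
  field_simp
  ring

lemma hasDerivAt_signedBessel (ε : ℝ) (k : ℕ) {x : ℝ} (hx : x ≠ 0) :
    HasDerivAt (signedBessel ε k)
      (k / x * signedBessel ε k x + ε * signedBessel ε (k + 1) x) x := by
  have h1 : HasDerivAt (fun x : ℝ => x / 2) (1 / 2) x := (hasDerivAt_id x).div_const 2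
  have h := (h1.pow k).mul
    ((hasDerivAt_besselClifford k (ε * (x / 2) ^ 2)).comp x ((h1.pow 2).const_mul ε))
  refine h.congr_deriv ?_
  simp only [signedBessel, Pi.pow_apply, Function.comp]
  cases k with
  | zero => simp; field_simp
  | succ k =>
    simp only [Nat.add_sub_cancel]
    push_cast
    field_simp
    ring

lemma hasDerivAt_signedBessel_succ (ε : ℝ) (k : ℕ) {x : ℝ} (hx : x ≠ 0) :
    HasDerivAt (signedBessel ε (k + 1))
      (signedBessel ε k x - (k + 1) / x * signedBessel ε (k + 1) x) x := by
  refine (hasDerivAt_signedBessel ε (k + 1) hx).congr_deriv ?_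
  rw [signedBessel_recurrence ε k hx]
  push_cast
  field_simp
  ring

lemma eventually_signedBessel_pos (ε : ℝ) (k : ℕ) :
    ∃ δ > 0, ∀ x, 0 < x → x < δ → 0 < signedBessel ε k x := by
  have hc : ContinuousAt (fun x : ℝ => besselClifford k (ε * (x / 2) ^ 2)) 0 := by
    have := continuous_besselClifford k
    fun_prop
  have h0 : 0 < besselClifford k (ε * ((0 : ℝ) / 2) ^ 2) := by
    simpa using besselClifford_pos k le_rfl
  obtain ⟨δ, hδ, h⟩ := Metric.eventually_nhds_iff.1 (hc.eventually (lt_mem_nhds h0))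
  refine ⟨δ, hδ, fun x hx hxδ => mul_pos (by positivity) (h ?_)⟩
  simpa [abs_of_pos hx] using hxδ

lemma signedBessel_one_pos (k : ℕ) {x : ℝ} (hx : 0 < x) : 0 < signedBessel 1 k x :=
  mul_pos (by positivity) (besselClifford_pos k (by positivity))

/-- Turán's inequality for `J` and `I`. -/
lemma signedBessel_turan (ε : ℝ) (k : ℕ) {x : ℝ} (hx : 0 < x) :
    0 < signedBessel ε (k + 1) x ^ 2 - signedBessel ε k x * signedBessel ε (k + 2) x := by
  set E : ℝ → ℝ := fun x =>
    x ^ 2 * (signedBessel ε (k + 1) x ^ 2 - signedBessel ε k x * signedBessel ε (k + 2) x)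
  have hE : ∀ x, x ≠ 0 → HasDerivAt E (2 * x * signedBessel ε (k + 1) x ^ 2) x := by
    intro x hx
    have h0 := hasDerivAt_signedBessel ε k hx
    have h1 := hasDerivAt_signedBessel_succ ε k hx
    have h2 := hasDerivAt_signedBessel_succ ε (k + 1) hx
    refine ((hasDerivAt_pow 2 x).mul ((h1.pow 2).sub (h0.mul h2))).congr_deriv ?_
    simp only [Pi.pow_apply, Pi.mul_apply, Pi.sub_apply]
    rw [signedBessel_recurrence ε k hx]
    push_cast
    field_simp
    ring
  have hc : Continuous E := by
    have := continuous_signedBessel ε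
    fun_prop
  obtain ⟨δ, hδ, hpos⟩ := eventually_signedBessel_pos ε (k + 1)
  have hm : MonotoneOn E (Set.Ici 0) := by
    refine monotoneOn_of_deriv_nonneg (convex_Ici 0) hc.continuousOn ?_ ?_
    · intro y hy
      rw [interior_Ici] at hy
      exact (hE y (ne_of_gt hy)).differentiableAt.differentiableWithinAt
    · intro y hy
      rw [interior_Ici] at hy
      have : 0 < y := hy
      rw [(hE y (ne_of_gt hy)).deriv]
      positivity
  -- E' may vanish at zeros of the function of order k+1, so strict growth is taken only near 0,
  -- where that function is positive.
  have hs : StrictMonoOn E (Set.Icc 0 (min (δ / 2) x)) := by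
    refine strictMonoOn_of_deriv_pos (convex_Icc _ _) hc.continuousOn ?_
    intro y hy
    rw [interior_Icc] at hy
    have h0 : 0 < y := hy.1
    have h1 : y < δ := by linarith [hy.2, min_le_left (δ / 2) x]
    have := hpos y h0 h1
    rw [(hE y h0.ne').deriv]
    positivity
  have hmin : 0 < min (δ / 2) x := by positivity
  have h1 : E 0 < E (min (δ / 2) x) := hs ⟨le_rfl, hmin.le⟩ ⟨hmin.le, le_rfl⟩ hmin
  have h2 : E (min (δ / 2) x) ≤ E x := hm hmin.le hx.le (min_le_right _ _)
  have h3 : 0 < E x := by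
    have : E 0 = 0 := by simp [E]
    linarith
  exact pos_of_mul_pos_right h3 (by positivity)

/-! ### Positive zeros of J_k: existence, enumeration, signs, interlacing -/

lemma continuous_besselJ (k : ℕ) : Continuous (besselJ k) := by
  rw [besselJ_eq]; exact continuous_signedBessel _ k

lemma hasDerivAt_besselJ (k : ℕ) {x : ℝ} (hx : x ≠ 0) :
    HasDerivAt (besselJ k) (k / x * besselJ k x - besselJ (k + 1) x) x := by
  have := hasDerivAt_signedBessel (-1) k hx
  rw [besselJ_eq, besselJ_eq]
  exact this.congr_deriv (by ring)

lemma hasDerivAt_besselJ_succ (k : ℕ) {x : ℝ} (hx : x ≠ 0) :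
    HasDerivAt (besselJ (k + 1)) (besselJ k x - (k + 1) / x * besselJ (k + 1) x) x := by
  rw [besselJ_eq, besselJ_eq]
  exact hasDerivAt_signedBessel_succ (-1) k hx

lemma eventually_besselJ_pos (k : ℕ) : ∃ δ > 0, ∀ x, 0 < x → x < δ → 0 < besselJ k x := by
  rw [besselJ_eq]; exact eventually_signedBessel_pos (-1) k

/-- A common zero would turn Turán's inequality into 0 < 0. As J_k' = -J_{k+1} at a positive zero of
J_k, such zeros are simple. -/
lemma besselJ_succ_ne_zero {k : ℕ} {x : ℝ} (hx : 0 < x) (h : besselJ k x = 0) :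
    besselJ (k + 1) x ≠ 0 := by
  intro h'
  have := signedBessel_turan (-1) k hx
  rw [← besselJ_eq, ← besselJ_eq, h, h'] at this
  simp at this

/-- Sturm comparison of `√x J_0(x)` with `sin (x - a)`. -/
lemma exists_besselJ_zero_eq_zero {a : ℝ} (ha : 0 < a) : ∃ x, a ≤ x ∧ besselJ 0 x = 0 := by
  by_contra! hne
  have hc := continuous_besselJ 0
  have hpi := Real.pi_pos
  obtain ⟨σ, hσ⟩ : ∃ σ : ℝ, ∀ x ∈ Set.Icc a (a + Real.pi), 0 < σ * besselJ 0 x := by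
    rcases (hne a le_rfl).lt_or_gt with h | h
    · refine ⟨-1, fun x hx => ?_⟩
      by_contra! hx'
      obtain ⟨y, hy, hy0⟩ := intermediate_value_Icc hx.1 hc.continuousOn
        (show (0 : ℝ) ∈ Set.Icc _ _ from ⟨h.le, by linarith⟩)
      exact hne y hy.1 hy0
    · refine ⟨1, fun x hx => ?_⟩
      by_contra! hx'
      obtain ⟨y, hy, hy0⟩ := intermediate_value_Icc' hx.1 hc.continuousOn
        (show (0 : ℝ) ∈ Set.Icc _ _ from ⟨by linarith, h.le⟩)
      exact hne y hy.1 hy0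
  -- The Wronskian f' sin(x - a) - f cos(x - a) of f = σ √x J_0, where f'' = -(1 + 1/(4x²)) f.
  set W : ℝ → ℝ := fun x => σ * ((besselJ 0 x / (2 * √x) - √x * besselJ 1 x) * Real.sin (x - a)
    - √x * besselJ 0 x * Real.cos (x - a))
  have hW : ∀ x, 0 < x → HasDerivAt W
      (-(1 / (4 * x * √x)) * (σ * besselJ 0 x) * Real.sin (x - a)) x := by
    intro x hx
    have hsx : 0 < √x := Real.sqrt_pos.2 hx
    have hs2 : √x ^ 2 = x := Real.sq_sqrt hx.le
    have h0 := hasDerivAt_besselJ 0 hx.ne'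
    have h1 := hasDerivAt_besselJ_succ 0 hx.ne'
    have hs := Real.hasDerivAt_sqrt hx.ne'
    have hl : HasDerivAt (fun y => y - a) 1 x := (hasDerivAt_id x).sub_const a
    have hsin := (Real.hasDerivAt_sin (x - a)).comp x hl
    have hcos := (Real.hasDerivAt_cos (x - a)).comp x hl
    refine (((((h0.div (hs.const_mul 2) (by positivity)).sub (hs.mul h1)).mul hsin).sub
      ((hs.mul h0).mul hcos)).const_mul σ).congr_deriv ?_
    simp only [Pi.mul_apply, Pi.sub_apply, Pi.div_apply, Function.comp, zero_add]
    generalize √x = q at *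
    subst hs2
    field_simp
    ring
  have hanti : AntitoneOn W (Set.Icc a (a + Real.pi)) := by
    refine antitoneOn_of_deriv_nonpos (convex_Icc _ _)
      (fun x hx => (hW x (ha.trans_le hx.1)).continuousAt.continuousWithinAt) ?_ ?_
    · intro x hx
      rw [interior_Icc] at hx
      exact (hW x (ha.trans hx.1)).differentiableAt.differentiableWithinAt
    · intro x hx
      rw [interior_Icc] at hx
      have hx0 : 0 < x := ha.trans hx.1
      rw [(hW x hx0).deriv]
      have h1 := hσ x ⟨hx.1.le, hx.2.le⟩
      have h2 : 0 < Real.sin (x - a) :=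
        Real.sin_pos_of_pos_of_lt_pi (by linarith [hx.1]) (by linarith [hx.2])
      rw [neg_mul, neg_mul]
      exact neg_nonpos.2 (by positivity)
  -- W(a) = -f(a) < 0 < f(a + π) = W(a + π), against W decreasing.
  have h1 := hanti ⟨le_rfl, by linarith⟩ ⟨by linarith, le_rfl⟩
    (show a ≤ a + Real.pi by linarith)
  simp only [W, sub_self, add_sub_cancel_left, Real.sin_zero, Real.cos_zero, Real.sin_pi,
    Real.cos_pi] at h1
  have h2 := mul_pos (Real.sqrt_pos.2 ha) (hσ a ⟨le_rfl, by linarith⟩)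
  have h3 := mul_pos (Real.sqrt_pos.2 (show 0 < a + Real.pi by linarith))
    (hσ (a + Real.pi) ⟨by linarith, le_rfl⟩)
  nlinarith

/-- Between two positive zeros of `J_k` there is a zero of `J_{k+1}`. -/
lemma exists_besselJ_succ_eq_zero {k : ℕ} {a b : ℝ} (ha : 0 < a) (hab : a < b)
    (hJa : besselJ k a = 0) (hJb : besselJ k b = 0) :
    ∃ x, a < x ∧ x < b ∧ besselJ (k + 1) x = 0 := by
  -- Rolle's theorem is applied to x^{-k} J_k.
  have hd : ∀ x, 0 < x → HasDerivAt (fun x => besselJ k x / x ^ k)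
      (-(besselJ (k + 1) x / x ^ k)) x := by
    intro x hx
    refine ((hasDerivAt_besselJ k hx.ne').div (hasDerivAt_pow k x) (by positivity)).congr_deriv ?_
    cases k with
    | zero => simp
    | succ k =>
      simp only [Nat.add_sub_cancel]
      field_simp
      ring
  obtain ⟨x, hx, h⟩ := exists_hasDerivAt_eq_zero hab
    (fun x hx => (hd x (ha.trans_le hx.1)).continuousAt.continuousWithinAt)
    (by simp [hJa, hJb]) (fun x hx => hd x (ha.trans hx.1))
  have hx0 : 0 < x := ha.trans hx.1
  refine ⟨x, hx.1, hx.2, ?_⟩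
  have : x ^ k ≠ 0 := by positivity
  simpa [this] using h

/-- Between two zeros of `x^{k+1} J_{k+1}(x)` there is a zero of `J_k`. -/
lemma exists_besselJ_eq_zero {k : ℕ} {a b : ℝ} (ha : 0 ≤ a) (hab : a < b)
    (hJa : a = 0 ∨ besselJ (k + 1) a = 0) (hJb : besselJ (k + 1) b = 0) :
    ∃ x, a < x ∧ x < b ∧ besselJ k x = 0 := by
  have hc := continuous_besselJ (k + 1)
  obtain ⟨x, hx, h⟩ := exists_hasDerivAt_eq_zero (f := fun x => x ^ (k + 1) * besselJ (k + 1) x)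
    (f' := fun x => x ^ (k + 1) * besselJ k x) hab (by fun_prop)
    (by rcases hJa with h | h <;> simp [h, hJb]) (fun x hx => by
      have hx0 : x ≠ 0 := (ha.trans_lt hx.1).ne'
      refine ((hasDerivAt_pow (k + 1) x).mul (hasDerivAt_besselJ_succ k hx0)).congr_deriv ?_
      simp only [Nat.add_sub_cancel]
      push_cast
      field_simp
      ring)
  have hx0 : 0 < x := ha.trans_lt hx.1
  refine ⟨x, hx.1, hx.2, ?_⟩
  have : x ^ (k + 1) ≠ 0 := by positivity
  simpa [this] using h

lemma exists_besselJ_eq_zero_gt (k : ℕ) (a : ℝ) : ∃ x, a < x ∧ besselJ k x = 0 := by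
  induction k generalizing a with
  | zero =>
    obtain ⟨x, hx, h⟩ := exists_besselJ_zero_eq_zero (a := |a| + 1) (by positivity)
    exact ⟨x, by linarith [le_abs_self a], h⟩
  | succ k ih =>
    obtain ⟨x, hx, h⟩ := ih |a|
    obtain ⟨y, hy, h'⟩ := ih x
    obtain ⟨z, hz, -, h''⟩ :=
      exists_besselJ_succ_eq_zero ((abs_nonneg a).trans_lt hx) hy h h'
    exact ⟨z, by linarith [le_abs_self a], h''⟩

lemma besselJZero_succ_le {k ℓ : ℕ} {x : ℝ} (hx : besselJZero k ℓ < x) (h : besselJ k x = 0) :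
    besselJZero k (ℓ + 1) ≤ x := by
  rw [besselJZero]
  exact csInf_le ⟨besselJZero k ℓ, fun y hy => hy.1.le⟩ ⟨hx, h⟩

/-- The infimum defining the next zero is attained once zeros do not accumulate at the current one:
the gap makes the set of later zeros closed. -/
lemma besselJZero_succ_spec_of_gap {k ℓ : ℕ} {δ : ℝ} (hδ : 0 < δ)
    (hgap : ∀ x, besselJZero k ℓ < x → x < besselJZero k ℓ + δ → besselJ k x ≠ 0) :
    besselJZero k ℓ < besselJZero k (ℓ + 1) ∧ besselJ k (besselJZero k (ℓ + 1)) = 0 := by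
  have hset : {x : ℝ | besselJZero k ℓ < x ∧ besselJ k x = 0} =
      Set.Ici (besselJZero k ℓ + δ) ∩ besselJ k ⁻¹' {0} := by
    ext x
    constructor
    · rintro ⟨h1, h2⟩
      exact ⟨not_lt.1 fun h => hgap x h1 h h2, h2⟩
    · rintro ⟨h1, h2⟩
      exact ⟨lt_of_lt_of_le (by linarith) h1, h2⟩
  have hcl : IsClosed {x : ℝ | besselJZero k ℓ < x ∧ besselJ k x = 0} := by
    rw [hset]
    exact isClosed_Ici.inter (isClosed_singleton.preimage (continuous_besselJ k))
  exact hcl.csInf_mem (exists_besselJ_eq_zero_gt k _) ⟨besselJZero k ℓ, fun y hy => hy.1.le⟩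

lemma eventually_besselJ_ne_zero {k : ℕ} {a : ℝ} (ha : 0 < a) (h : besselJ k a = 0) :
    ∃ δ > 0, ∀ x, x ≠ a → |x - a| < δ → besselJ k x ≠ 0 := by
  have hd := hasDerivAt_besselJ k ha.ne'
  rw [h, mul_zero, zero_sub] at hd
  have := hd.eventually_ne (c := 0) (neg_ne_zero.2 (besselJ_succ_ne_zero ha h))
  rw [eventually_nhdsWithin_iff] at this
  obtain ⟨δ, hδ, hne⟩ := Metric.eventually_nhds_iff.1 this
  exact ⟨δ, hδ, fun x hx hxa => hne hxa hx⟩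

lemma besselJZero_spec (k ℓ : ℕ) :
    0 ≤ besselJZero k ℓ ∧ besselJZero k ℓ < besselJZero k (ℓ + 1) ∧
      besselJ k (besselJZero k (ℓ + 1)) = 0 := by
  induction ℓ with
  | zero =>
    obtain ⟨δ, hδ, h⟩ := eventually_besselJ_pos k
    refine ⟨le_rfl, besselJZero_succ_spec_of_gap hδ fun x hx hx' => (h x hx ?_).ne'⟩
    simpa [besselJZero] using hx'
  | succ ℓ ih =>
    have hpos : 0 < besselJZero k (ℓ + 1) := ih.1.trans_lt ih.2.1
    obtain ⟨δ, hδ, h⟩ := eventually_besselJ_ne_zero hpos ih.2.2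
    refine ⟨hpos.le, besselJZero_succ_spec_of_gap hδ fun x hx hx' => h x hx.ne' ?_⟩
    rw [abs_of_pos] <;> linarith

lemma besselJZero_lt_succ (k ℓ : ℕ) : besselJZero k ℓ < besselJZero k (ℓ + 1) :=
  (besselJZero_spec k ℓ).2.1

lemma besselJZero_succ_pos (k ℓ : ℕ) : 0 < besselJZero k (ℓ + 1) :=
  (besselJZero_spec k ℓ).1.trans_lt (besselJZero_lt_succ k ℓ)

lemma besselJ_besselJZero_succ (k ℓ : ℕ) : besselJ k (besselJZero k (ℓ + 1)) = 0 :=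
  (besselJZero_spec k ℓ).2.2

lemma besselJ_ne_zero_of_mem {k ℓ : ℕ} {x : ℝ} (h1 : besselJZero k ℓ < x)
    (h2 : x < besselJZero k (ℓ + 1)) : besselJ k x ≠ 0 :=
  fun h => (besselJZero_succ_le h1 h).not_gt h2

/-- Every positive number lies in one of the intervals cut out by the zeros of `J_k`. -/
lemma exists_besselJZero_lt_le (k : ℕ) {x : ℝ} (hx : 0 < x) :
    ∃ ℓ, besselJZero k ℓ < x ∧ x ≤ besselJZero k (ℓ + 1) := by
  by_contra! hne
  have hlt : ∀ ℓ, besselJZero k ℓ < x := by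
    intro ℓ
    induction ℓ with
    | zero => exact hx
    | succ ℓ ih => exact hne ℓ ih
  have hmono : StrictMono (besselJZero k) := strictMono_nat_of_lt_succ (besselJZero_lt_succ k)
  have hbdd : BddAbove (Set.range (besselJZero k)) :=
    ⟨x, by rintro _ ⟨ℓ, rfl⟩; exact (hlt ℓ).le⟩
  have hlim := tendsto_atTop_ciSup hmono.monotone hbdd
  -- A bounded sequence of zeros would converge to a non-isolated zero L.
  set L := ⨆ ℓ, besselJZero k ℓ
  have hltL : ∀ ℓ, besselJZero k ℓ < L :=
    fun ℓ => (besselJZero_lt_succ k ℓ).trans_le (le_ciSup hbdd _)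
  have hlim' := hlim.comp (Filter.tendsto_add_atTop_nat 1)
  have hJL : besselJ k L = 0 := by
    refine tendsto_nhds_unique (((continuous_besselJ k).tendsto L).comp hlim') ?_
    refine tendsto_const_nhds.congr fun ℓ => ?_
    exact (besselJ_besselJZero_succ k ℓ).symm
  obtain ⟨δ, hδ, h⟩ := eventually_besselJ_ne_zero
    ((besselJZero_succ_pos k 0).trans (hltL 1)) hJL
  obtain ⟨ℓ, hℓ⟩ := (hlim'.eventually (Metric.ball_mem_nhds L hδ)).exists
  exact h _ (hltL (ℓ + 1)).ne hℓ (besselJ_besselJZero_succ k ℓ)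

/-- `J_k` has the sign `(-1)^ℓ` between its zeros number `ℓ` and `ℓ + 1`. -/
lemma besselJ_sign {k ℓ : ℕ} {x : ℝ} (h1 : besselJZero k ℓ < x)
    (h2 : x < besselJZero k (ℓ + 1)) : 0 < (-1) ^ ℓ * besselJ k x := by
  have hc := continuous_besselJ k
  have hivt : ∀ ℓ, (∃ y, besselJZero k ℓ < y ∧ y < besselJZero k (ℓ + 1) ∧
      0 < (-1) ^ ℓ * besselJ k y) → ∀ x, besselJZero k ℓ < x → x < besselJZero k (ℓ + 1) →
      0 < (-1) ^ ℓ * besselJ k x := by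
    rintro ℓ ⟨y, hy1, hy2, hy⟩ x h1 h2
    by_contra! hx
    obtain ⟨z, hz, hz0⟩ := (convex_Ioo (besselJZero k ℓ)
      (besselJZero k (ℓ + 1))).isPreconnected.intermediate_value ⟨h1, h2⟩ ⟨hy1, hy2⟩
      (f := fun z => (-1) ^ ℓ * besselJ k z) (by fun_prop)
      (show (0 : ℝ) ∈ Set.Icc _ _ from ⟨hx, hy.le⟩)
    refine besselJ_ne_zero_of_mem hz.1 hz.2 ?_
    simpa using hz0
  refine hivt ℓ ?_ x h1 h2
  clear h1 h2 x
  induction ℓ with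
  | zero =>
    obtain ⟨δ, hδ, h⟩ := eventually_besselJ_pos k
    have hp := besselJZero_succ_pos k 0
    have hm : 0 < min δ (besselJZero k (0 + 1)) := lt_min hδ hp
    refine ⟨min δ (besselJZero k (0 + 1)) / 2, by simpa [besselJZero] using ⟨hδ, hp⟩, ?_, ?_⟩
    · linarith [min_le_right δ (besselJZero k (0 + 1))]
    · simpa using h _ (by linarith) (by linarith [min_le_left δ (besselJZero k (0 + 1))])
  | succ ℓ ih =>
    by_contra! hneg
    set p := besselJZero k (ℓ + 1)
    have hp0 : besselJ k p = 0 := besselJ_besselJZero_succ k ℓ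
    have hp : 0 < p := besselJZero_succ_pos k ℓ
    -- Without a sign change at p, the zero p would be a local minimum of (-1)^ℓ J_k, hence not
    -- simple.
    have hmin : IsLocalMin (fun z => (-1) ^ ℓ * besselJ k z) p := by
      filter_upwards [Ioo_mem_nhds (besselJZero_lt_succ k ℓ) (besselJZero_lt_succ k (ℓ + 1))]
        with z hz
      rw [hp0, mul_zero]
      rcases lt_trichotomy z p with h | h | h
      · exact (hivt ℓ ih z hz.1 h).le
      · rw [h, hp0, mul_zero]
      · have := hneg z h hz.2
        rw [pow_succ] at this
        linarith
    have h0 := hmin.hasDerivAt_eq_zero ((hasDerivAt_besselJ k hp.ne').const_mul ((-1) ^ ℓ))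
    rw [hp0, mul_zero, zero_sub] at h0
    exact besselJ_succ_ne_zero hp hp0 (by simpa using h0)

/-- Each step from one zero of x^{k+1} J_{k+1} to the next, starting from 0, passes a zero of J_k.
-/
lemma besselJZero_lt_besselJZero_succ (k ℓ : ℕ) :
    besselJZero k (ℓ + 1) < besselJZero (k + 1) (ℓ + 1) := by
  have key : ∀ ℓ, besselJZero k ℓ ≤ besselJZero (k + 1) ℓ →
      besselJZero k (ℓ + 1) < besselJZero (k + 1) (ℓ + 1) := by
    intro ℓ h
    obtain ⟨x, hx1, hx2, hx⟩ := exists_besselJ_eq_zero (k := k) (besselJZero_spec (k + 1) ℓ).1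
      (besselJZero_lt_succ (k + 1) ℓ)
      (by cases ℓ with
        | zero => exact Or.inl rfl
        | succ ℓ => exact Or.inr (besselJ_besselJZero_succ (k + 1) ℓ))
      (besselJ_besselJZero_succ (k + 1) ℓ)
    exact (besselJZero_succ_le (h.trans_lt hx1) hx).trans_lt hx2
  induction ℓ with
  | zero => exact key 0 le_rfl
  | succ ℓ ih => exact key _ ih.le

lemma besselJZero_succ_lt_besselJZero (k ℓ : ℕ) :
    besselJZero (k + 1) ℓ < besselJZero k (ℓ + 1) := by
  induction ℓ with
  | zero => exact besselJZero_succ_pos k 0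
  | succ ℓ ih =>
    obtain ⟨x, hx1, hx2, hx⟩ := exists_besselJ_succ_eq_zero (besselJZero_succ_pos k ℓ)
      (besselJZero_lt_succ k (ℓ + 1)) (besselJ_besselJZero_succ k ℓ)
      (besselJ_besselJZero_succ k (ℓ + 1))
    exact (besselJZero_succ_le (ih.trans hx1) hx).trans_lt hx2

/-! ### Bounds for I_k, and j_{0,1} > 1 -/

lemma besselI_pos (k : ℕ) {x : ℝ} (hx : 0 < x) : 0 < besselI k x := by
  rw [besselI_eq]; exact signedBessel_one_pos k hx

lemma hasDerivAt_besselI (k : ℕ) {x : ℝ} (hx : x ≠ 0) :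
    HasDerivAt (besselI k) (k / x * besselI k x + besselI (k + 1) x) x := by
  have := hasDerivAt_signedBessel 1 k hx
  rw [besselI_eq, besselI_eq]
  exact this.congr_deriv (by ring)

lemma hasDerivAt_besselI_succ (k : ℕ) {x : ℝ} (hx : x ≠ 0) :
    HasDerivAt (besselI (k + 1)) (besselI k x - (k + 1) / x * besselI (k + 1) x) x := by
  rw [besselI_eq, besselI_eq]
  exact hasDerivAt_signedBessel_succ 1 k hx

/-- Turán's inequality with I_{k+2} eliminated by the recurrence. -/
lemma besselI_turan (k : ℕ) {x : ℝ} (hx : 0 < x) :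
    x ^ 2 * besselI k x ^ 2 <
      x ^ 2 * besselI (k + 1) x ^ 2 + 2 * (k + 1) * x * besselI k x * besselI (k + 1) x := by
  have h := signedBessel_turan 1 k hx
  have hr := signedBessel_recurrence 1 k hx.ne'
  rw [one_mul] at hr
  rw [← sub_eq_iff_eq_add'.2 hr, ← besselI_eq, ← besselI_eq] at h
  have := mul_pos (pow_pos hx 2) h
  field_simp at this
  linarith

lemma besselJ_zero_pos {x : ℝ} (h0 : 0 ≤ x) (h1 : x ≤ 1) : 0 < besselJ 0 x := by
  rw [besselJ_eq, signedBessel, pow_zero, one_mul]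
  set t := -1 * (x / 2) ^ 2
  have ht : |t| ≤ 1 / 4 := by
    rw [abs_le]; constructor <;> simp only [t] <;> nlinarith
  -- Adding the series of e^{|t|} makes all terms nonnegative; the term m = 0 equals 2, so C_0(t) ≥
  -- 2 - e^{|t|} ≥ 2 - e^{1/4} > 0.
  have hsum := (summable_besselClifford 0 t).add (Real.summable_pow_div_factorial |t|)
  have hle := hsum.le_tsum 0 (fun m _ => by
    have := neg_le_of_abs_le (abs_besselClifford_term_le 0 m t)
    linarith)
  rw [(summable_besselClifford 0 t).tsum_add (Real.summable_pow_div_factorial |t|)] at hle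
  have hexp : Real.exp |t| = ∑' m : ℕ, |t| ^ m / m.factorial := by
    rw [Real.exp_eq_exp_ℝ, NormedSpace.exp_eq_tsum_div]
  rw [← hexp] at hle
  have h4 : Real.exp |t| ≤ Real.exp (1 / 4) := Real.exp_le_exp.2 ht
  have h5 := Real.add_one_le_exp (-(1 / 4) : ℝ)
  have h6 : Real.exp (-(1 / 4)) * Real.exp (1 / 4) = 1 := by rw [← Real.exp_add]; simp
  have h7 := Real.exp_pos (1 / 4)
  change _ ≤ besselClifford 0 t + _ at hle
  norm_num at hle h5
  nlinarith

lemma one_lt_besselJZero_zero : 1 < besselJZero 0 1 := by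
  by_contra! h
  exact (besselJ_zero_pos (besselJZero_succ_pos 0 0).le h).ne' (besselJ_besselJZero_succ 0 0)

/-! ### Roots of F_k: simplicity, location, existence, uniqueness -/

/-- A function whose derivative is positive at each of its zeros has at most one zero. -/
lemma not_lt_of_zeros_of_deriv_pos {f f' : ℝ → ℝ} {a b : ℝ}
    (hf : ∀ x ∈ Set.Icc a b, HasDerivAt f (f' x) x)
    (hpos : ∀ x ∈ Set.Icc a b, f x = 0 → 0 < f' x) (ha : f a = 0) (hb : f b = 0) : ¬ a < b := by
  intro hab
  have hnonneg : ∀ x ∈ Set.Icc a b, 0 ≤ f x := by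
    intro x hx
    have := image_le_of_deriv_right_lt_deriv_boundary' (f := fun x => -f x) (f' := fun x => -f' x)
      (B := fun _ => 0) (B' := fun _ => 0) (a := a) (b := b)
      (fun x hx => (hf x hx).continuousAt.neg.continuousWithinAt)
      (fun x hx => (hf x ⟨hx.1, hx.2.le⟩).neg.hasDerivWithinAt) (by simp [ha])
      continuousOn_const (fun x _ => (hasDerivAt_const x 0).hasDerivWithinAt)
      (fun x hx h => by
        have := hpos x ⟨hx.1, hx.2.le⟩ (by simpa using h)
        simpa using this) hx
    simpa using this
  have hd := hf b ⟨hab.le, le_rfl⟩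
  have hp := hpos b ⟨hab.le, le_rfl⟩ hb
  -- Since f ≥ 0 = f(b), slopes from the left at b are nonpositive, against f'(b) > 0.
  have hev : ∀ᶠ x in nhdsWithin b (Set.Iio b), slope f b x ≤ 0 := by
    filter_upwards [Ioo_mem_nhdsLT hab] with x hx
    rw [slope_def_field, hb, sub_zero]
    exact div_nonpos_of_nonneg_of_nonpos (hnonneg x ⟨hx.1.le, hx.2.le⟩) (by linarith [hx.2])
  exact hp.not_ge (le_of_tendsto
    ((hasDerivAt_iff_tendsto_slope_left_right.1 hd).1) hev)

section

variable {k : ℕ} {κ x : ℝ}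

lemma charF_eq (k : ℕ) (hκ : 0 < κ) (hx : 0 < x) :
    charF k κ x = κ / x * besselJ k x * besselI (k + 1) (κ / x)
      + x * besselI k (κ / x) * besselJ (k + 1) x := by
  have hy : 0 < κ / x := by positivity
  rw [charF, (hasDerivAt_besselI k hy.ne').deriv, (hasDerivAt_besselJ k hx.ne').deriv]
  field_simp
  ring

/-- The derivative of `charF` in terms of Bessel functions. -/
lemma hasDerivAt_charF (k : ℕ) (hκ : 0 < κ) (hx : 0 < x) :
    HasDerivAt (charF k κ)
      ((-(κ / x) * besselJ k x * besselI (k + 1) (κ / x)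
        + (κ / x) * (k * besselJ k x - x * besselJ (k + 1) x) * besselI (k + 1) (κ / x)
        - (κ / x) * besselJ k x * (κ / x * besselI k (κ / x) - (k + 1) * besselI (k + 1) (κ / x))
        + x * besselI k (κ / x) * besselJ (k + 1) x
        - x * (k * besselI k (κ / x) + κ / x * besselI (k + 1) (κ / x)) * besselJ (k + 1) x
        + x * besselI k (κ / x) * (x * besselJ k x - (k + 1) * besselJ (k + 1) x)) / x) x := by
  have hy : 0 < κ / x := by positivity
  have hd : HasDerivAt (fun x => κ / x) (-κ / x ^ 2) x := by
    exact ((hasDerivAt_const x κ).div (hasDerivAt_id x) hx.ne').congr_deriv (by simp)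
  have h := ((hd.mul (hasDerivAt_besselJ k hx.ne')).mul
    ((hasDerivAt_besselI_succ k hy.ne').comp x hd)).add
    (((hasDerivAt_id x).mul ((hasDerivAt_besselI k hy.ne').comp x hd)).mul
      (hasDerivAt_besselJ_succ k hx.ne'))
  refine (h.congr_of_eventuallyEq ?_).congr_deriv ?_
  · filter_upwards [lt_mem_nhds hx] with z hz
    exact charF_eq k hκ hz
  · simp only [Pi.mul_apply, Function.comp, id]
    field_simp
    ring

/-- At a zero of `charF`, its derivative is nonzero and has the sign of `J_k`. -/
lemma besselJ_mul_deriv_charF_pos (hκ : 0 < κ) (hx : 0 < x) (hk : k = 0 → 1 ≤ x)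
    (h0 : charF k κ x = 0) : 0 < besselJ k x * deriv (charF k κ) x := by
  have hy : 0 < κ / x := by positivity
  have hp := besselI_pos k hy
  have hq := besselI_pos (k + 1) hy
  have hT := besselI_turan k hy
  rw [(hasDerivAt_charF k hκ hx).deriv]
  rw [charF_eq k hκ hx] at h0
  have hJ := @besselJ_succ_ne_zero k x hx
  generalize κ / x = y at *
  generalize besselJ k x = a at *
  generalize besselJ (k + 1) x = b at *
  generalize besselI k y = p at *
  generalize besselI (k + 1) y = q at *
  have ha : a ≠ 0 := by
    intro ha
    refine hJ ha ?_
    rw [ha] at h0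
    have : x * p ≠ 0 := by positivity
    simpa [this] using h0
  -- This form times a²/(xp) is J_k F_k' after eliminating b = J_{k+1}(x). Turán bounds y²p² by y²q²
  -- + 2(k+1)ypq. For k ≥ 1, 4k ≥ 2(k+1) suffices; for k = 0 the remaining -2ypq is absorbed in (p -
  -- yq)², using x ≥ 1.
  have hQ : 0 < x ^ 2 * p ^ 2 - y ^ 2 * p ^ 2 + 2 * y ^ 2 * q ^ 2 + 4 * k * y * q * p := by
    rcases Nat.eq_zero_or_pos k with rfl | hk'
    · have h1 := hk rfl
      have h2 : p ^ 2 ≤ x ^ 2 * p ^ 2 := by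
        have : 1 ≤ x ^ 2 := by nlinarith
        nlinarith [sq_nonneg p]
      push_cast at *
      nlinarith [sq_nonneg (p - y * q)]
    · have h1 : (1 : ℝ) ≤ k := by exact_mod_cast hk'
      have h2 : 0 < y * q * p := by positivity
      nlinarith [mul_nonneg (sub_nonneg.2 h1) h2.le, mul_pos (pow_pos hx 2) (pow_pos hp 2),
        mul_pos (pow_pos hy 2) (pow_pos hq 2)]
  have hb : b = -(y * a * q) / (x * p) := by
    field_simp
    linarith
  have ha2 : 0 < a ^ 2 := by positivity
  have : 0 < a ^ 2 * (x ^ 2 * p ^ 2 - y ^ 2 * p ^ 2 + 2 * y ^ 2 * q ^ 2 + 4 * k * y * q * p)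
      / (x * p) := by positivity
  convert this using 1
  rw [hb]
  field_simp
  ring

/-- Between consecutive zeros of J_{k+1} (or 0 and the first), J_k and J_{k+1} have the same sign up
to the zero of J_k there, so both summands of F_k agree in sign and cannot cancel. -/
lemma exists_besselJZero_of_charF_eq_zero (hκ : 0 < κ) (hx : 0 < x) (h0 : charF k κ x = 0) :
    ∃ ℓ, besselJZero k (ℓ + 1) < x ∧ x < besselJZero (k + 1) (ℓ + 1) := by
  have hy : 0 < κ / x := by positivity
  have hp := mul_pos hx (besselI_pos k hy)
  have hq := mul_pos hy (besselI_pos (k + 1) hy)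
  rw [charF_eq k hκ hx] at h0
  obtain ⟨ℓ, h1, h2⟩ := exists_besselJZero_lt_le (k + 1) hx
  have h2' : x < besselJZero (k + 1) (ℓ + 1) := by
    refine lt_of_le_of_ne h2 fun h => ?_
    have hb : besselJ (k + 1) x = 0 := by rw [h]; exact besselJ_besselJZero_succ (k + 1) ℓ
    refine besselJ_succ_ne_zero hx ?_ hb
    rw [hb, mul_zero, add_zero, mul_right_comm] at h0
    simpa [hq.ne'] using h0
  refine ⟨ℓ, not_le.1 fun h3 => ?_, h2'⟩
  have hb := besselJ_sign h1 h2'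
  have hkl : besselJZero k ℓ ≤ besselJZero (k + 1) ℓ := by
    cases ℓ with
    | zero => exact le_rfl
    | succ ℓ => exact (besselJZero_lt_besselJZero_succ k ℓ).le
  have ha : 0 ≤ (-1) ^ ℓ * besselJ k x := by
    rcases h3.lt_or_eq with h | h
    · exact (besselJ_sign (hkl.trans_lt h1) h).le
    · rw [h, besselJ_besselJZero_succ, mul_zero]
  have : 0 < (-1) ^ ℓ * (κ / x * besselJ k x * besselI (k + 1) (κ / x)
      + x * besselI k (κ / x) * besselJ (k + 1) x) := by
    nlinarith [mul_pos hp hb, mul_nonneg hq.le ha]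
  rw [h0, mul_zero] at this
  exact this.false

lemma besselJZero_monotone (k : ℕ) : StrictMono (besselJZero k) :=
  strictMono_nat_of_lt_succ (besselJZero_lt_succ k)

lemma one_le_of_besselJZero_lt {ℓ : ℕ} (h : besselJZero k (ℓ + 1) < x) : k = 0 → 1 ≤ x := by
  rintro rfl
  exact (one_lt_besselJZero_zero.trans_le
    ((besselJZero_monotone 0).monotone (Nat.le_add_left 1 ℓ))).le.trans h.le

lemma exists_charF_eq_zero (k ℓ : ℕ) (hκ : 0 < κ) :
    ∃ x, besselJZero k (ℓ + 1) < x ∧ x < besselJZero (k + 1) (ℓ + 1) ∧ charF k κ x = 0 := by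
  set a := besselJZero k (ℓ + 1)
  set b := besselJZero (k + 1) (ℓ + 1)
  have ha : 0 < a := besselJZero_succ_pos k ℓ
  have hab : a < b := besselJZero_lt_besselJZero_succ k ℓ
  have hb : 0 < b := ha.trans hab
  have hJa : 0 < (-1) ^ ℓ * besselJ (k + 1) a :=
    besselJ_sign (besselJZero_succ_lt_besselJZero k ℓ) hab
  have hJb : 0 < (-1) ^ (ℓ + 1) * besselJ k b :=
    besselJ_sign hab (besselJZero_succ_lt_besselJZero k (ℓ + 1))
  have hc : ContinuousOn (fun x => (-1) ^ ℓ * charF k κ x) (Set.Icc a b) := fun x hx =>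
    ((hasDerivAt_charF k hκ (ha.trans_le hx.1)).continuousAt.const_mul _).continuousWithinAt
  have hFa : 0 < (-1) ^ ℓ * charF k κ a := by
    rw [charF_eq k hκ ha, besselJ_besselJZero_succ k ℓ]
    nlinarith [mul_pos (mul_pos ha (besselI_pos k (div_pos hκ ha))) hJa]
  have hFb : (-1) ^ ℓ * charF k κ b < 0 := by
    rw [charF_eq k hκ hb, besselJ_besselJZero_succ (k + 1) ℓ]
    rw [pow_succ] at hJb
    nlinarith [mul_pos (mul_pos (div_pos hκ hb) (besselI_pos (k + 1) (div_pos hκ hb))) hJb]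
  obtain ⟨x, hx, h0⟩ := intermediate_value_Ioo' hab.le hc
    (show (0 : ℝ) ∈ Set.Ioo _ _ from ⟨hFb, hFa⟩)
  exact ⟨x, hx.1, hx.2, by simpa using h0⟩

/-- On the interval J_k has sign (-1)^{ℓ+1}, so (-1)^{ℓ+1} F_k has positive derivative at each of
its zeros. -/
lemma charF_zero_not_lt {ℓ : ℕ} {x z : ℝ} (hκ : 0 < κ) (hx : besselJZero k (ℓ + 1) < x)
    (hz : z < besselJZero (k + 1) (ℓ + 1)) (hx0 : charF k κ x = 0) (hz0 : charF k κ z = 0) :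
    ¬ x < z := by
  have hpos := besselJZero_succ_pos k ℓ
  refine not_lt_of_zeros_of_deriv_pos (f := fun w => (-1) ^ (ℓ + 1) * charF k κ w)
    (f' := fun w => (-1) ^ (ℓ + 1) * deriv (charF k κ) w) (fun w hw => ?_) (fun w hw h0 => ?_)
    (by simp [hx0]) (by simp [hz0])
  · exact ((hasDerivAt_charF k hκ
      (hpos.trans (hx.trans_le hw.1))).differentiableAt.hasDerivAt).const_mul _
  · have hw1 := hx.trans_le hw.1
    have hw2 := hw.2.trans_lt hz
    have hs := besselJ_sign hw1 (hw2.trans (besselJZero_succ_lt_besselJZero k (ℓ + 1)))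
    have := besselJ_mul_deriv_charF_pos hκ (hpos.trans hw1) (one_le_of_besselJZero_lt hw1)
      (by simpa using h0)
    have h1 : ((-1 : ℝ) ^ (ℓ + 1)) * (-1) ^ (ℓ + 1) = 1 := by
      rw [← mul_pow]; simp
    refine pos_of_mul_pos_right (a := (-1) ^ (ℓ + 1) * besselJ k w) ?_ hs.le
    calc (0 : ℝ) < besselJ k w * deriv (charF k κ) w := this
      _ = (((-1 : ℝ) ^ (ℓ + 1)) * (-1) ^ (ℓ + 1)) * (besselJ k w * deriv (charF k κ) w) := by
        rw [h1, one_mul]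
      _ = _ := by ring

lemma deriv_charF_ne_zero (hκ : 0 < κ) (hx : 0 < x) (h0 : charF k κ x = 0) :
    deriv (charF k κ) x ≠ 0 := by
  obtain ⟨ℓ, h1, -⟩ := exists_besselJZero_of_charF_eq_zero hκ hx h0
  exact right_ne_zero_of_mul
    (besselJ_mul_deriv_charF_pos hκ hx (one_le_of_besselJZero_lt h1) h0).ne'

end

/-! ### Laplace eigenfunctions in the plane -/

lemma iteratedFDeriv_two_eq_of_hasDerivAt {f g : ℂ → ℂ} {v z h : ℂ} (hf : ContDiff ℝ 2 f)
    (hg : ∀ w, HasDerivAt (fun t : ℝ => f (w + t • v)) (g w) 0)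
    (hh : HasDerivAt (fun t : ℝ => g (z + t • v)) h 0) :
    iteratedFDeriv ℝ 2 f z ![v, v] = h := by
  have h1 : ∀ w, fderiv ℝ f w v = g w := fun w =>
    (((hf.differentiable (by norm_num)) w).hasFDerivAt.hasLineDerivAt v).unique (hg w)
  have hd : DifferentiableAt ℝ (fderiv ℝ f) z :=
    ((hf.fderiv_right (m := 1) (by norm_num)).differentiable (by norm_num)) z
  have h2 : HasFDerivAt g ((ContinuousLinearMap.apply ℝ ℂ v).comp (fderiv ℝ (fderiv ℝ f) z)) z := by
    have := (ContinuousLinearMap.apply ℝ ℂ v).hasFDerivAt.comp z hd.hasFDerivAt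
    refine this.congr_of_eventuallyEq (Filter.Eventually.of_forall fun w => ?_)
    exact (h1 w).symm
  rw [iteratedFDeriv_two_apply]
  exact (h2.hasLineDerivAt v).unique hh

/-- The solution `z^k C_k(s|z|²)` of `Δ u = 4 s u`. -/
noncomputable def planeMode (k : ℕ) (s : ℝ) (z : ℂ) : ℂ :=
  z ^ k * (besselClifford k (s * Complex.normSq z) : ℂ)

lemma contDiff_normSq {n : ℕ∞} : ContDiff ℝ n fun z : ℂ => Complex.normSq z := by
  have : (fun z : ℂ => Complex.normSq z) = fun z => ‖z‖ ^ 2 :=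
    funext Complex.normSq_eq_norm_sq
  rw [this]
  exact contDiff_norm_sq ℝ

lemma contDiff_planeMode (k : ℕ) (s : ℝ) {n : ℕ∞} : ContDiff ℝ n (planeMode k s) := by
  have h1 := contDiff_besselClifford k (n := n)
  have h2 := contDiff_normSq (n := n)
  have h3 : ContDiff ℝ n (fun x : ℝ => (x : ℂ)) := Complex.ofRealCLM.contDiff
  have h4 : ContDiff ℝ n fun z : ℂ => (besselClifford k (s * Complex.normSq z) : ℂ) :=
    h3.comp (h1.comp (contDiff_const.mul h2))
  exact (contDiff_id.pow k).mul h4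

lemma hasDerivAt_line_pow (k : ℕ) (z v : ℂ) :
    HasDerivAt (fun t : ℝ => (z + t • v) ^ k) (k * z ^ (k - 1) * v) 0 := by
  have h : HasDerivAt (fun t : ℝ => z + t • v) v 0 := by
    simpa using ((hasDerivAt_id (0 : ℝ)).smul_const v).const_add z
  exact (h.pow k).congr_deriv (by simp)

lemma hasDerivAt_line_besselClifford (k : ℕ) (s : ℝ) (z v : ℂ) :
    HasDerivAt (fun t : ℝ => (besselClifford k (s * Complex.normSq (z + t • v)) : ℂ))
      (2 * s * (z.re * v.re + z.im * v.im) *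
        besselClifford (k + 1) (s * Complex.normSq z)) 0 := by
  have h : HasDerivAt (fun t : ℝ => s * Complex.normSq (z + t • v))
      (s * (2 * (z.re * v.re + z.im * v.im))) 0 := by
    have hre : HasDerivAt (fun t : ℝ => z.re + t * v.re) v.re 0 := by
      simpa using ((hasDerivAt_id (0 : ℝ)).mul_const v.re).const_add z.re
    have him : HasDerivAt (fun t : ℝ => z.im + t * v.im) v.im 0 := by
      simpa using ((hasDerivAt_id (0 : ℝ)).mul_const v.im).const_add z.im
    have := ((hre.mul hre).add (him.mul him)).const_mul s
    refine (this.congr_of_eventuallyEq (Filter.Eventually.of_forall fun t => ?_)).congr_deriv ?_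
    · simp [Complex.normSq_apply]
    · simp only [zero_mul, add_zero]; ring
  have h0 : s * Complex.normSq (z + (0 : ℝ) • v) = s * Complex.normSq z := by simp
  have hC := hasDerivAt_besselClifford k (s * Complex.normSq z)
  rw [← h0] at hC
  have := (hC.comp 0 h).ofReal_comp
  refine this.congr_deriv ?_
  rw [h0]
  push_cast
  ring

lemma hasDerivAt_line_planeMode (k : ℕ) (s : ℝ) (z v : ℂ) :
    HasDerivAt (fun t : ℝ => planeMode k s (z + t • v))
      (k * z ^ (k - 1) * v * besselClifford k (s * Complex.normSq z)
        + z ^ k * (2 * s * (z.re * v.re + z.im * v.im)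
          * besselClifford (k + 1) (s * Complex.normSq z))) 0 := by
  have := (hasDerivAt_line_pow k z v).mul (hasDerivAt_line_besselClifford k s z v)
  refine this.congr_deriv ?_
  simp

lemma iteratedFDeriv_two_planeMode (k : ℕ) (s : ℝ) (z v : ℂ) :
    iteratedFDeriv ℝ 2 (planeMode k s) z ![v, v] =
      k * (k - 1 : ℕ) * z ^ (k - 1 - 1) * v ^ 2 * besselClifford k (s * Complex.normSq z)
      + 4 * s * (k * z ^ (k - 1)) * (v * (z.re * v.re + z.im * v.im))
        * besselClifford (k + 1) (s * Complex.normSq z)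
      + 2 * s * z ^ k * (v.re * v.re + v.im * v.im)
        * besselClifford (k + 1) (s * Complex.normSq z)
      + 4 * s ^ 2 * z ^ k * (z.re * v.re + z.im * v.im) ^ 2
        * besselClifford (k + 2) (s * Complex.normSq z) := by
  refine iteratedFDeriv_two_eq_of_hasDerivAt (contDiff_planeMode k s (n := 2))
    (fun w => hasDerivAt_line_planeMode k s w v) ?_
  have hin : HasDerivAt
      (fun t : ℝ => 2 * (s : ℂ) * ((z + t • v).re * v.re + (z + t • v).im * v.im))
      (2 * s * (v.re * v.re + v.im * v.im)) 0 := by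
    have hre : HasDerivAt (fun t : ℝ => z.re + t * v.re) v.re 0 := by
      simpa using ((hasDerivAt_id (0 : ℝ)).mul_const v.re).const_add z.re
    have him : HasDerivAt (fun t : ℝ => z.im + t * v.im) v.im 0 := by
      simpa using ((hasDerivAt_id (0 : ℝ)).mul_const v.im).const_add z.im
    have := ((hre.ofReal_comp.mul_const (v.re : ℂ)).add
      (him.ofReal_comp.mul_const (v.im : ℂ))).const_mul (2 * (s : ℂ))
    refine this.congr_of_eventuallyEq (Filter.Eventually.of_forall fun t => ?_)
    simp
  have h := ((((hasDerivAt_line_pow (k - 1) z v).const_mul (k : ℂ)).mul_const v).mul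
    (hasDerivAt_line_besselClifford k s z v)).add
    ((hasDerivAt_line_pow k z v).mul (hin.mul (hasDerivAt_line_besselClifford (k + 1) s z v)))
  refine h.congr_deriv ?_
  simp only [Pi.mul_apply, zero_smul, add_zero]
  ring

/-- Summing over v = 1, i, the z^{k-2} terms cancel since i² = -1, and Σ v (z·v) = z. What is left
is 4s z^k ((k+1) C_{k+1} + s|z|² C_{k+2}), which the recurrence collapses. -/
lemma laplacian_planeMode (k : ℕ) (s : ℝ) (z : ℂ) :
    Δ (planeMode k s) z = 4 * s * planeMode k s z := by
  rw [laplacian_eq_iteratedFDeriv_complexPlane]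
  simp only [iteratedFDeriv_two_planeMode, planeMode]
  rw [besselClifford_recurrence k]
  have hz : (z.re : ℂ) + z.im * Complex.I = z := Complex.re_add_im z
  have hk : (k : ℂ) * z ^ (k - 1) * z = k * z ^ k := by
    cases k with
    | zero => simp
    | succ k => rw [Nat.add_sub_cancel, pow_succ]; ring
  have hn : (Complex.normSq z : ℂ) = z.re ^ 2 + z.im ^ 2 := by
    rw [Complex.normSq_apply]; push_cast; ring
  have hI : Complex.I ^ 2 = -1 := Complex.I_sq
  push_cast
  simp only [Complex.one_re, Complex.one_im, Complex.I_re, Complex.I_im, Complex.ofReal_one,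
    Complex.ofReal_zero]
  generalize (besselClifford (k + 1) (s * Complex.normSq z) : ℂ) = c1
  generalize (besselClifford (k + 2) (s * Complex.normSq z) : ℂ) = c2
  rw [hn]
  linear_combination (k * (k - 1 : ℕ) * z ^ (k - 1 - 1) *
    ((k + 1) * c1 + s * (z.re ^ 2 + z.im ^ 2) * c2)) * hI
    + 4 * s * c1 * hk + 4 * s * (k * z ^ (k - 1)) * c1 * hz

/-! ### Polar modes as clamped eigenfunctions -/

lemma planeMode_eq_polarMode (ε β : ℝ) (k : ℕ) :
    polarMode (fun r => signedBessel ε k (β * r)) k =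
      fun z => ((β / 2 : ℝ) : ℂ) ^ k * planeMode k (ε * (β / 2) ^ 2) z := by
  funext z
  have h : (‖z‖ : ℂ) ^ k * Complex.exp (Complex.I * (k : ℤ) * Complex.arg z) = z ^ k := by
    rw [show Complex.I * (k : ℤ) * (Complex.arg z : ℂ) = k * (Complex.arg z * Complex.I) by
      push_cast; ring, Complex.exp_nat_mul, ← mul_pow, Complex.norm_mul_exp_arg_mul_I]
  rw [polarMode, planeMode, ← h, signedBessel, Complex.normSq_eq_norm_sq]
  rw [show ε * (β * ‖z‖ / 2) ^ 2 = ε * (β / 2) ^ 2 * ‖z‖ ^ 2 by ring]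
  push_cast
  ring

/-- The problem has real coefficients; conjugation yields the modes e^{-ikθ}. -/
lemma IsEigenfunction.conj {κ lam : ℝ} {u : ℂ → ℂ} (hu : ContDiff ℝ 4 u)
    (h : IsEigenfunction κ lam u) : IsEigenfunction κ lam (fun z => starRingEnd ℂ (u z)) := by
  have hcomp : (fun z => starRingEnd ℂ (u z)) = Complex.conjCLE ∘ u := rfl
  refine ⟨?_, ?_, ?_, ?_, ?_⟩
  · rw [hcomp]
    exact (Complex.conjCLE.contDiff.comp hu).contDiffOn
  · intro z hz
    rw [hcomp, laplacian_CLE_comp_left, laplacian_CLE_comp_left]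
    have := congrArg (starRingEnd ℂ) (h.equation z hz)
    simpa using this
  · intro z hz
    simp [h.boundary_value z hz]
  · intro z hz
    rw [hcomp, Complex.conjCLE.comp_fderivWithin
      (uniqueDiffOn_convex (convex_closedBall (0 : ℂ) 1) (by simp [interior_closedBall]) z
        (sphere_subset_closedBall hz))]
    simp [h.boundary_normal z hz]
  · obtain ⟨z, hz, hne⟩ := h.nontrivial
    exact ⟨z, hz, by simpa using hne⟩

lemma polarMode_neg (R : ℝ → ℝ) (n : ℤ) :
    polarMode R (-n) = fun z => starRingEnd ℂ (polarMode R n z) := by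
  funext z
  simp only [polarMode, map_mul, Complex.conj_ofReal, ← Complex.exp_conj, Complex.conj_I, map_intCast]
  congr 2
  push_cast
  ring

lemma fderivWithin_polarMode_eq_zero {R : ℝ → ℝ} {n : ℤ} {z : ℂ}
    (hu : DifferentiableAt ℝ (polarMode R n) z) (hz : z ∈ sphere (0 : ℂ) 1)
    (hR : HasDerivAt R 0 1) : fderivWithin ℝ (polarMode R n) (closedBall 0 1) z z = 0 := by
  have hz1 : ‖z‖ = 1 := by simpa using hz
  rw [fderivWithin_eq_fderiv (uniqueDiffOn_convex (convex_closedBall (0 : ℂ) 1)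
    (by simp [interior_closedBall]) z (sphere_subset_closedBall hz)) hu]
  have h1 : HasDerivAt (fun t : ℝ => polarMode R n (z + t • z)) (fderiv ℝ (polarMode R n) z z) 0 :=
    hu.hasFDerivAt.hasLineDerivAt z
  have h2 : HasDerivAt
      (fun t : ℝ => (R (1 + t) : ℂ) * Complex.exp (Complex.I * n * Complex.arg z)) 0 0 := by
    have hl : HasDerivAt (fun t : ℝ => 1 + t) 1 0 := (hasDerivAt_id (0 : ℝ)).const_add 1
    rw [show (1 : ℝ) = 1 + 0 by simp] at hR
    have := ((hR.comp 0 hl).ofReal_comp).mul_const (Complex.exp (Complex.I * n * Complex.arg z))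
    simpa using this
  refine h1.unique (h2.congr_of_eventuallyEq ?_)
  -- The argument is constant along the ray through z as long as 1 + t > 0.
  filter_upwards [lt_mem_nhds (show (-1 : ℝ) < 0 by norm_num)] with t ht
  have ht' : 0 < 1 + t := by linarith
  have : z + t • z = ((1 + t : ℝ) : ℂ) * z := by
    rw [Complex.real_smul]; push_cast; ring
  rw [polarMode, this, Complex.arg_real_mul z ht', norm_mul, hz1, mul_one, Complex.norm_real,
    Real.norm_of_nonneg ht'.le]

section

variable {k : ℕ} {κ α c d : ℝ}

lemma polarMode_radialProfile :
    polarMode (radialProfile k κ α c d) k =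
      ((c : ℂ) * ((α / 2 : ℝ) : ℂ) ^ k) • planeMode k (-1 * (α / 2) ^ 2)
      + ((d : ℂ) * ((κ / α / 2 : ℝ) : ℂ) ^ k) • planeMode k (1 * (κ / α / 2) ^ 2) := by
  have h1 := planeMode_eq_polarMode (-1) α k
  have h2 := planeMode_eq_polarMode 1 (κ / α) k
  funext z
  have h1 := congrFun h1 z
  have h2 := congrFun h2 z
  simp only [Pi.add_apply, Pi.smul_apply, smul_eq_mul, mul_assoc]
  rw [← h1, ← h2]
  simp only [polarMode, radialProfile, besselJ_eq, besselI_eq]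
  push_cast
  ring

lemma contDiff_polarMode_radialProfile {n : ℕ∞} :
    ContDiff ℝ n (polarMode (radialProfile k κ α c d) k) := by
  rw [polarMode_radialProfile]
  exact (contDiff_const.smul (contDiff_planeMode _ _)).add
    (contDiff_const.smul (contDiff_planeMode _ _))

lemma laplacian_combination (A B : ℂ) (s t : ℝ) (z : ℂ) :
    Δ (A • planeMode k s + B • planeMode k t) z =
      A * (4 * s) * planeMode k s z + B * (4 * t) * planeMode k t z := by
  have hs := (contDiff_planeMode k s (n := 2)).contDiffAt (x := z)
  have ht := (contDiff_planeMode k t (n := 2)).contDiffAt (x := z)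
  rw [ContDiffAt.laplacian_add (f₁ := A • planeMode k s) (f₂ := B • planeMode k t)
      (hs.const_smul A) (ht.const_smul B),
    laplacian_smul A hs, laplacian_smul B ht, laplacian_planeMode, laplacian_planeMode]
  simp only [smul_eq_mul]
  ring

lemma laplacian_combination_eq (A B : ℂ) (s t : ℝ) :
    Δ (A • planeMode k s + B • planeMode k t) =
      (A * (4 * s)) • planeMode k s + (B * (4 * t)) • planeMode k t :=
  funext fun z => laplacian_combination A B s t z

lemma hasDerivAt_radialProfile_one (hκ : 0 < κ) (hα : 0 < α) (h : BoundarySystem k κ α c d) :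
    HasDerivAt (radialProfile k κ α c d) 0 1 := by
  have hd : ∀ β : ℝ, HasDerivAt (fun r : ℝ => β * r) β 1 := fun β => by
    simpa using (hasDerivAt_id (1 : ℝ)).const_mul β
  have hJ : HasDerivAt (besselJ k) (deriv (besselJ k) α) (α * 1) := by
    rw [mul_one]; exact (hasDerivAt_besselJ k hα.ne').differentiableAt.hasDerivAt
  have hI : HasDerivAt (besselI k) (deriv (besselI k) (κ / α)) (κ / α * 1) := by
    rw [mul_one]
    exact (hasDerivAt_besselI k (div_pos hκ hα).ne').differentiableAt.hasDerivAt
  have := ((hJ.comp 1 (hd α)).const_mul c).add ((hI.comp 1 (hd (κ / α))).const_mul d)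
  refine this.congr_deriv ?_
  rw [← h.2]
  ring

lemma planeMode_not_eqOn_zero (k : ℕ) (s : ℝ) : ∃ z ∈ ball (0 : ℂ) 1, planeMode k s z ≠ 0 := by
  have hc : ContinuousAt (fun x : ℝ => besselClifford k (s * (x * x))) 0 := by
    have := continuous_besselClifford k
    fun_prop
  have h0 : 0 < besselClifford k (s * ((0 : ℝ) * 0)) := by
    simpa using besselClifford_pos k le_rfl
  obtain ⟨r, h, hr0, hr1⟩ := (((hc.eventually (lt_mem_nhds h0)).filter_mono
    nhdsWithin_le_nhds).and (Ioo_mem_nhdsGT (show (0 : ℝ) < 1 by norm_num))).exists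
  refine ⟨r, by simpa [abs_of_pos hr0] using hr1, mul_ne_zero (pow_ne_zero _ ?_) ?_⟩
  · exact_mod_cast hr0.ne'
  · rw [Complex.normSq_ofReal]
    exact_mod_cast h.ne'

lemma isEigenfunction_polarMode (hκ : 0 < κ) (hα : 0 < α) (hcd : (c, d) ≠ (0, 0))
    (h : BoundarySystem k κ α c d) :
    IsEigenfunction κ (α ^ 2 - κ ^ 2 / α ^ 2) (polarMode (radialProfile k κ α c d) k) := by
  have hα' : (α : ℂ) ≠ 0 := by exact_mod_cast hα.ne'
  refine ⟨contDiff_polarMode_radialProfile.contDiffOn, ?_, ?_, ?_, ?_⟩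
  · intro z _
    rw [polarMode_radialProfile, laplacian_combination_eq, laplacian_combination]
    simp only [Pi.add_apply, Pi.smul_apply, smul_eq_mul]
    push_cast
    field_simp
    ring
  · intro z hz
    have hz1 : ‖z‖ = 1 := by simpa using hz
    rw [polarMode, hz1, radialProfile, mul_one, mul_one, h.1]
    simp
  · intro z hz
    exact fderivWithin_polarMode_eq_zero
      ((contDiff_polarMode_radialProfile (n := 1)).differentiable (by norm_num) z) hz
      (hasDerivAt_radialProfile_one hκ hα h)
  · by_contra! h0
    rw [polarMode_radialProfile] at h0
    obtain ⟨z, hz, hne⟩ := planeMode_not_eqOn_zero k (-1 * (α / 2) ^ 2)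
    have h1 := h0 z hz
    have h2 := (laplacian_congr_nhds (f₂ := fun _ : ℂ => (0 : ℂ))
      (Filter.eventuallyEq_of_mem (isOpen_ball.mem_nhds hz) h0)).self_of_nhds
    rw [laplacian_combination, laplacian_const] at h2
    simp only [Pi.add_apply, Pi.smul_apply, Pi.zero_apply, smul_eq_mul] at h1 h2
    -- Combining u = 0 with Δu = 0 eliminates the I-part, as the Laplace eigenvalues -α² and (κ/α)²
    -- differ.
    have h3 : (c : ℂ) * ((α / 2 : ℝ) : ℂ) ^ k * planeMode k (-1 * (α / 2) ^ 2) z *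
        ((α ^ 2 + (κ / α) ^ 2 : ℝ) : ℂ) = 0 := by
      push_cast at h1 h2 ⊢
      linear_combination (κ / α : ℂ) ^ 2 * h1 - h2
    have h4 : ((α ^ 2 + (κ / α) ^ 2 : ℝ) : ℂ) ≠ 0 := by
      have : 0 < α ^ 2 + (κ / α) ^ 2 := by positivity
      exact_mod_cast this.ne'
    have h5 : ((α / 2 : ℝ) : ℂ) ≠ 0 := by
      have : 0 < α / 2 := by positivity
      exact_mod_cast this.ne'
    have hc : c = 0 := by
      exact_mod_cast (mul_eq_zero.1 ((mul_eq_zero.1 ((mul_eq_zero.1 h3).resolve_right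
        h4)).resolve_right hne)).resolve_right (pow_ne_zero k h5)
    have hd : d = 0 := by
      have := h.1
      rw [hc] at this
      simpa [(besselI_pos k (div_pos hκ hα)).ne'] using this
    exact hcd (by rw [hc, hd])

lemma isEigenfunction_polarMode_neg (hκ : 0 < κ) (hα : 0 < α) (hcd : (c, d) ≠ (0, 0))
    (h : BoundarySystem k κ α c d) :
    IsEigenfunction κ (α ^ 2 - κ ^ 2 / α ^ 2) (polarMode (radialProfile k κ α c d) (-k)) := by
  rw [polarMode_neg]
  exact (isEigenfunction_polarMode hκ hα hcd h).conj (contDiff_polarMode_radialProfile (n := 4))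

lemma exists_boundarySystem (hκ : 0 < κ) (hα : 0 < α) (h0 : charF k κ α = 0) :
    ∃ c d : ℝ, (c, d) ≠ (0, 0) ∧ BoundarySystem k κ α c d := by
  have hI := besselI_pos k (div_pos hκ hα)
  -- This solves the first equation identically; the left side of the second becomes -F_k(α).
  refine ⟨besselI k (κ / α), -besselJ k α, fun h => hI.ne' (Prod.ext_iff.1 h).1, by ring, ?_⟩
  rw [charF] at h0
  linear_combination -h0

end

end BallBuckling

/-! ### Assembly -/

theorem theorem3p4 (k : ℕ) (κ : ℝ) (hκ : 0 < κ) :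
    (∀ x : ℝ, 0 < x → BallBuckling.charF k κ x = 0 → deriv (BallBuckling.charF k κ) x ≠ 0) ∧
    ∃ α : ℕ+ → ℝ,
      StrictMono α ∧
      Set.range α = {x : ℝ | 0 < x ∧ BallBuckling.charF k κ x = 0} ∧
      (∀ ℓ : ℕ+, BallBuckling.besselJZero k ℓ < α ℓ ∧
        α ℓ < BallBuckling.besselJZero (k + 1) ℓ) ∧
      ∀ ℓ : ℕ+,
        BallBuckling.IsEigenvalue κ (α ℓ ^ 2 - κ ^ 2 / α ℓ ^ 2) ∧
        (∃ c d : ℝ, (c, d) ≠ (0, 0) ∧ BallBuckling.BoundarySystem k κ (α ℓ) c d) ∧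
        ∀ c d : ℝ, (c, d) ≠ (0, 0) → BallBuckling.BoundarySystem k κ (α ℓ) c d →
          BallBuckling.IsEigenfunction κ (α ℓ ^ 2 - κ ^ 2 / α ℓ ^ 2)
            (BallBuckling.polarMode (BallBuckling.radialProfile k κ (α ℓ) c d) k) ∧
          BallBuckling.IsEigenfunction κ (α ℓ ^ 2 - κ ^ 2 / α ℓ ^ 2)
            (BallBuckling.polarMode (BallBuckling.radialProfile k κ (α ℓ) c d) (-k)) := by
  refine ⟨fun x hx h0 => BallBuckling.deriv_charF_ne_zero hκ hx h0, ?_⟩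
  choose β hβ1 hβ2 hβ0 using fun ℓ => BallBuckling.exists_charF_eq_zero k ℓ hκ
  have hβpos : ∀ ℓ, 0 < β ℓ := fun ℓ => (BallBuckling.besselJZero_succ_pos k ℓ).trans (hβ1 ℓ)
  -- With ℓ counted from 0, β_ℓ < j_{k+1,ℓ+1} < j_{k,ℓ+2} < β_{ℓ+1}.
  have hmono : StrictMono β := strictMono_nat_of_lt_succ fun ℓ =>
    ((hβ2 ℓ).trans (BallBuckling.besselJZero_succ_lt_besselJZero k (ℓ + 1))).trans (hβ1 (ℓ + 1))
  refine ⟨fun ℓ => β ℓ.natPred, fun a b hab => hmono (PNat.natPred_strictMono hab), ?_, ?_, ?_⟩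
  · ext x
    constructor
    · rintro ⟨ℓ, rfl⟩
      exact ⟨hβpos _, hβ0 _⟩
    · rintro ⟨hx, h0⟩
      obtain ⟨ℓ, h1, h2⟩ := BallBuckling.exists_besselJZero_of_charF_eq_zero hκ hx h0
      refine ⟨ℓ.succPNat, ?_⟩
      simp only [Nat.natPred_succPNat]
      exact le_antisymm
        (not_lt.1 (BallBuckling.charF_zero_not_lt hκ h1 (hβ2 ℓ) h0 (hβ0 ℓ)))
        (not_lt.1 (BallBuckling.charF_zero_not_lt hκ (hβ1 ℓ) h2 (hβ0 ℓ) h0))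
  · intro ℓ
    have h1 := hβ1 ℓ.natPred
    have h2 := hβ2 ℓ.natPred
    rw [PNat.natPred_add_one] at h1 h2
    exact ⟨h1, h2⟩
  · intro ℓ
    have hpos := hβpos ℓ.natPred
    obtain ⟨c, d, hcd, hs⟩ := BallBuckling.exists_boundarySystem hκ hpos (hβ0 ℓ.natPred)
    exact ⟨⟨_, BallBuckling.isEigenfunction_polarMode hκ hpos hcd hs⟩, ⟨c, d, hcd, hs⟩,
      fun c d hcd hs => ⟨BallBuckling.isEigenfunction_polarMode hκ hpos hcd hs,
        BallBuckling.isEigenfunction_polarMode_neg hκ hpos hcd hs⟩⟩
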